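/- For $\alpha,\beta>0$ let $E_{\alpha,\beta}(z)=\sum_{n=0}^{\infty}\frac{z^n}{\Gamma(\alpha n+\beta)}$ be the two-parametric Mittag-Leffler function. Let $1<\alpha<2$, $\beta>0$, and let $\theta$ be a real function on the unit sphere of $\mathbb{R}^N$. Then there is a constant $C>0$, depending only on $N$, $\alpha$, $\beta$ and $\theta$ (in particular independent of $\delta$, $k$ and $A$), such that the following holds. Let $\sigma\in C^\infty(\mathbb{R}^N\setminus\{0\};(0,\infty))$ be homogeneous of degree $k>0$, that is $\sigma(t\xi)=t^k\sigma(\xi)$ for $t>0$ and $\xi\ne0$, with $\sigma=\theta$ on the unit sphere, and suppose that $$\left|\partial^\gamma_\xi\sigma(\xi)\right|\le A\,|\xi|^{k-|\gamma|},\qquad \xi\neq 0,$$ for all multi-indices $\gamma\in(\mathbb{N}\cup\{0\})^N$ with $|\gamma|\le[N/2]+1$. If $\delta\ge 0$ and $$k\left(\frac{\beta}{\alpha}-\frac1\alpha\right)\le\delta<k,$$ then $\xi\mapsto|\xi|^\delta E_{\alpha,\beta}(-\sigma(\xi))$ is smooth on $\mathbb{R}^N\setminus\{0\}$ and $$\left|\partial^\gamma_\xi\left[|\xi|^\delta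 E_{\alpha,\beta}(-\sigma(\xi))\right]\right|\le C A\,|\xi|^{-|\gamma|},\qquad \xi\ne0,$$ for all multi-indices $\gamma$ with $|\gamma|\le[N/2]+1$. -/

import Mathlib

open scoped ContDiff

noncomputable section

/-- The two-parametric Mittag-Leffler function `E_{α,β}(z) = ∑ₙ zⁿ / Γ(α n + β)`. -/
def mittagLeffler (α β : ℝ) (z : ℂ) : ℂ :=
  ∑' n : ℕ, z ^ n / Complex.Gamma ((α * n + β : ℝ) : ℂ)

/-- The partial derivative `∂f/∂ξᵢ`. -/
def partialDeriv {N : ℕ} {F : Type*} [NormedAddCommGroup F] [NormedSpace ℝ F] (i : Fin N)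
    (f : EuclideanSpace ℝ (Fin N) → F) : EuclideanSpace ℝ (Fin N) → F :=
  fun ξ => lineDeriv ℝ f ξ (EuclideanSpace.single i (1 : ℝ))

/-- The derivative `∂^γ f = ∂₁^{γ₁} ⋯ ∂_N^{γ_N} f` of multi-index `γ`. -/
def multiDeriv {N : ℕ} {F : Type*} [NormedAddCommGroup F] [NormedSpace ℝ F] (γ : Fin N → ℕ)
    (f : EuclideanSpace ℝ (Fin N) → F) : EuclideanSpace ℝ (Fin N) → F :=
  (List.finRange N).foldr (fun i g => (partialDeriv i)^[γ i] g) f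

/-- The length `|γ| = γ₁ + ⋯ + γ_N` of a multi-index. -/
def multiLength {N : ℕ} (γ : Fin N → ℕ) : ℕ := ∑ i, γ i

/-- `σ` is (positively) homogeneous of degree `k` on `ℝ^N ∖ {0}`. -/
def HomogeneousOfDegree {N : ℕ} (k : ℝ) (σ : EuclideanSpace ℝ (Fin N) → ℝ) : Prop :=
  ∀ t : ℝ, 0 < t → ∀ ξ : EuclideanSpace ℝ (Fin N), ξ ≠ 0 → σ (t • ξ) = t ^ k * σ ξ

/-- `|∂^γ f(ξ)| ≤ B |ξ|^{d - |γ|}` for all `ξ ≠ 0` and all multi-indices `γ` with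
`|γ| ≤ [N/2] + 1`. -/
def SymbolBound {N : ℕ} {F : Type*} [NormedAddCommGroup F] [NormedSpace ℝ F] (d B : ℝ)
    (f : EuclideanSpace ℝ (Fin N) → F) : Prop :=
  ∀ γ : Fin N → ℕ, multiLength γ ≤ N / 2 + 1 → ∀ ξ : EuclideanSpace ℝ (Fin N), ξ ≠ 0 →
    ‖multiDeriv γ f ξ‖ ≤ B * ‖ξ‖ ^ (d - (multiLength γ : ℝ))

end

open MeasureTheory Set Filter Topology

open scoped FourierTransform Nat Real

/-!
Write `log σ(ξ) = k log |ξ| + φ(ξ)` with `φ` homogeneous of degree `0`. With `τ = δ / k ∈ [0, 1]`,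
`|ξ|^δ E_{α,β}(-σ(ξ)) = exp (-τ φ(ξ)) G_τ(log σ(ξ))`, where `G_τ(x) = exp (τ x) E_{α,β}(-exp x)`.

* All derivatives of `G_τ` are bounded, uniformly in `τ`. Inserting the Bromwich integral
  of `1 / Γ` over the line `Re t = 1` into the series gives, for `β > 1` and `Re s < 0`,
  `E_{α,β}(-exp s) = (2πi)⁻¹ ∫ exp t · t^(α-β) / (t^α + exp s) dt`. Since `α < 2`, the denominator
  stays away from `0` for `s` in a strip around the real axis, so the identity extends there
  analytically and the integral is, for large `β`, of size `O(1 / (1 + |exp s|))`. The recurrence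
  `E_{α,β} = β E_{α,β+1} + α z E'_{α,β+1}` carries this bound down to every `β`, and Cauchy's
  estimates turn it into bounds on derivatives.
* Dilations change `log |ξ|` and `φ` only by constants, so their derivatives of order `j ≥ 1` are
  `O(|ξ|^(-j))`. By the chain and Leibniz rules the derivatives of order `n` of the product are
  `O((1 + k)^n |ξ|^(-n))`.
* On a coordinate axis `σ` is a multiple of `t^k`, whose derivatives of order at most `[N/2] + 1`
  the symbol bound controls by `A`. Hence `(1 + k)^([N/2] + 1) = O(A)`, and `C` does not see `k`.
-/

section IntegralDependence

variable {X : Type*} [MeasurableSpace X] {μ : Measure X} {G : Type*} [NormedAddCommGroup G]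

theorem aestronglyMeasurable_deriv_of_eventually {𝕜 : Type*} [NontriviallyNormedField 𝕜]
    [NormedSpace 𝕜 G] {F : 𝕜 → X → G} {z₀ : 𝕜}
    (hF : ∀ᶠ z in 𝓝 z₀, AEStronglyMeasurable (F z) μ)
    (hd : ∀ᵐ x ∂μ, DifferentiableAt 𝕜 (F · x) z₀) :
    AEStronglyMeasurable (fun x => deriv (F · x) z₀) μ := by
  classical
  let q : 𝕜 → X → G := fun z x =>
    if AEStronglyMeasurable (F z) μ then slope (F · x) z₀ z else 0
  refine aestronglyMeasurable_of_tendsto_ae (𝓝[≠] z₀) (f := q) (fun z => ?_) ?_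
  · by_cases hz : AEStronglyMeasurable (F z) μ
    · simp only [q, hz, if_true, slope_def_module]
      exact (hz.sub hF.self_of_nhds).const_smul (z - z₀)⁻¹
    · simpa [q, hz] using aestronglyMeasurable_const
  · filter_upwards [hd] with x hx
    refine (hasDerivAt_iff_tendsto_slope.1 hx.hasDerivAt).congr' ?_
    filter_upwards [hF.filter_mono nhdsWithin_le_nhds] with z hz
    simp [q, hz]

variable [NormedSpace ℂ G] {F : ℂ → X → G} {b : X → ℝ} {U : Set ℂ}

theorem differentiableOn_integral_of_dominated (hU : IsOpen U)
    (hm : ∀ z ∈ U, AEStronglyMeasurable (F z) μ)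
    (hd : ∀ᵐ x ∂μ, DifferentiableOn ℂ (F · x) U)
    (hb : ∀ᵐ x ∂μ, ∀ z ∈ U, ‖F z x‖ ≤ b x) (hbi : Integrable b μ) :
    DifferentiableOn ℂ (fun z => ∫ x, F z x ∂μ) U := by
  intro z₀ hz₀
  obtain ⟨R, hR, hRU⟩ := Metric.nhds_basis_closedBall.mem_iff.1 (hU.mem_nhds hz₀)
  have hR₂ : 0 < R / 2 := half_pos hR
  have hball : ∀ z ∈ Metric.ball z₀ (R / 2), Metric.closedBall z (R / 2) ⊆ U := fun z hz =>
    (Metric.closedBall_subset_closedBall' (by linarith [Metric.mem_ball.1 hz])).trans hRU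
  have hmeas : ∀ᶠ z in 𝓝 z₀, AEStronglyMeasurable (F z) μ :=
    mem_of_superset (hU.mem_nhds hz₀) hm
  have hdiff : ∀ᵐ x ∂μ, ∀ z ∈ U, DifferentiableAt ℂ (F · x) z := by
    filter_upwards [hd] with x hx z hz using hx.differentiableAt (hU.mem_nhds hz)
  refine (hasDerivAt_integral_of_dominated_loc_of_deriv_le
    (F' := fun z x => deriv (F · x) z) (bound := fun x => b x / (R / 2))
    (Metric.ball_mem_nhds z₀ hR₂) hmeas
    (hbi.mono' (hm z₀ hz₀) (hb.mono fun x hx => hx z₀ hz₀))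
    (aestronglyMeasurable_deriv_of_eventually hmeas (hdiff.mono fun x hx => hx z₀ hz₀)) ?_
    (hbi.div_const _) ?_).2.differentiableAt.differentiableWithinAt
  · filter_upwards [hd, hb] with x hdx hbx z hz
    refine Complex.norm_deriv_le_of_forall_mem_sphere_norm_le hR₂
      (DifferentiableOn.diffContOnCl ?_)
      fun w hw => hbx w (hball z hz (Metric.sphere_subset_closedBall hw))
    rw [closure_ball _ hR₂.ne']
    exact hdx.mono (hball z hz)
  · filter_upwards [hdiff] with x hx z hz
    exact (hx z (hball z hz (Metric.mem_closedBall_self hR₂.le))).hasDerivAt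

theorem hasSum_integral_mul_pow {f g : X → ℂ} (hf : Integrable f μ)
    (hg : AEStronglyMeasurable g μ) {q : ℝ} (hq : q < 1) (hgq : ∀ x, ‖g x‖ ≤ q) :
    HasSum (fun n : ℕ => ∫ x, f x * g x ^ n ∂μ) (∫ x, f x / (1 - g x) ∂μ) := by
  rcases isEmpty_or_nonempty X with _ | ⟨⟨x₀⟩⟩
  · simp [integral_of_isEmpty, hasSum_zero]
  have hq₀ : 0 ≤ q := (norm_nonneg _).trans (hgq x₀)
  have hle : ∀ n x, ‖f x * g x ^ n‖ ≤ q ^ n * ‖f x‖ := fun n x => by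
    rw [norm_mul, norm_pow, mul_comm]
    gcongr
    exact hgq x
  have hint : ∀ n, Integrable (fun x => f x * g x ^ n) μ := fun n =>
    (hf.norm.const_mul (q ^ n)).mono' (hf.aestronglyMeasurable.mul (hg.pow n))
      (Eventually.of_forall (hle n))
  have hsum : Summable fun n : ℕ => ∫ x, ‖f x * g x ^ n‖ ∂μ := by
    refine Summable.of_nonneg_of_le (fun n => integral_nonneg fun x => norm_nonneg _) (fun n => ?_)
      ((summable_geometric_of_lt_one hq₀ hq).mul_right (∫ x, ‖f x‖ ∂μ))
    rw [← integral_const_mul]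
    exact integral_mono (hint n).norm (hf.norm.const_mul _) (hle n)
  have hgeom : ∀ x, ∑' n : ℕ, f x * g x ^ n = f x / (1 - g x) := fun x => by
    rw [tsum_mul_left, tsum_geometric_of_norm_lt_one ((hgq x).trans_lt hq), div_eq_mul_inv]
  simp_rw [← hgeom]
  exact hasSum_integral_of_summable_integral_norm hint hsum

end IntegralDependence

section ReciprocalGamma

open Complex

theorem continuousOn_ofReal_cpow_Ioi (a : ℂ) :
    ContinuousOn (fun t : ℝ => (t : ℂ) ^ a) (Ioi 0) :=
  continuous_ofReal.continuousOn.cpow_const fun _ ht => ofReal_mem_slitPlane.2 ht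

theorem differentiableOn_integral_cpow_mul_exp_neg_mul_Ioi {a : ℂ} (ha : 0 < a.re) {c : ℝ}
    (hc : 0 < c) :
    DifferentiableOn ℂ (fun r : ℂ => ∫ t : ℝ in Ioi 0, (t : ℂ) ^ (a - 1) * exp (-(r * t)))
      {r | c < r.re} := by
  refine differentiableOn_integral_of_dominated (isOpen_lt continuous_const continuous_re)
    (b := fun t : ℝ => t ^ (a.re - 1) * Real.exp (-c * t ^ (1 : ℝ))) (fun r _ => ?_)
    (Eventually.of_forall fun t => by fun_prop) ?_
    (integrableOn_rpow_mul_exp_neg_mul_rpow (by linarith) one_pos hc)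
  · exact ((continuousOn_ofReal_cpow_Ioi _).mul (by fun_prop)).aestronglyMeasurable
      measurableSet_Ioi
  · filter_upwards [ae_restrict_mem measurableSet_Ioi] with t (ht : 0 < t) r (hr : c < r.re)
    rw [norm_mul, norm_cpow_eq_rpow_re_of_pos ht, norm_exp, Real.rpow_one]
    have hre : (-(r * t)).re ≤ -c * t := by simpa using mul_le_mul_of_nonneg_right hr.le ht.le
    simp only [sub_re, one_re]
    gcongr

theorem integral_cpow_mul_exp_neg_mul_Ioi_of_re_pos {a r : ℂ} (ha : 0 < a.re) (hr : 0 < r.re) :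
    ∫ t : ℝ in Ioi 0, (t : ℂ) ^ (a - 1) * exp (-(r * t)) = Gamma a * r ^ (-a) := by
  obtain ⟨c, hc, hcr⟩ := exists_between hr
  have hU : IsOpen {r : ℂ | c < r.re} := isOpen_lt continuous_const continuous_re
  have hpow : DifferentiableOn ℂ (fun r : ℂ => Gamma a * r ^ (-a)) {r | c < r.re} := fun z hz =>
    ((differentiableAt_id.cpow_const (Or.inl (hc.trans hz))).const_mul _).differentiableWithinAt
  refine ((differentiableOn_integral_cpow_mul_exp_neg_mul_Ioi ha hc).analyticOnNhd
    hU).eqOn_of_preconnected_of_frequently_eq (hpow.analyticOnNhd hU)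
    (convex_halfSpace_re_gt c).isPreconnected (z₀ := (r.re : ℂ)) hcr ?_ hcr
  have hreal : Tendsto ((↑) : ℝ → ℂ) (𝓝[≠] r.re) (𝓝[≠] (r.re : ℂ)) :=
    continuous_ofReal.continuousWithinAt.tendsto_nhdsWithin fun _ hx => ofReal_injective.ne hx
  refine hreal.frequently (Eventually.frequently ?_)
  filter_upwards [nhdsWithin_le_nhds (Ioi_mem_nhds hr)] with x (hx : 0 < x)
  rw [integral_cpow_mul_exp_neg_mul_Ioi ha hx, one_div, inv_cpow _ _ ?_, cpow_neg, mul_comm]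
  rw [arg_ofReal_of_nonneg hx.le]
  exact Real.pi_pos.ne

/-- The parametrization `w ↦ 1 + 2πiw` of the line `Re t = 1`, in the frequency variable of the
Fourier transform. -/
noncomputable def verticalLine (w : ℝ) : ℂ := 1 + 2 * π * w * I

theorem verticalLine_re (w : ℝ) : (verticalLine w).re = 1 := by
  simp [verticalLine]

theorem verticalLine_ne_zero (w : ℝ) : verticalLine w ≠ 0 := fun h => by
  simpa [h] using verticalLine_re w

theorem one_le_norm_verticalLine (w : ℝ) : 1 ≤ ‖verticalLine w‖ := by
  simpa [verticalLine_re] using abs_re_le_norm (verticalLine w)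

theorem norm_exp_verticalLine (w : ℝ) : ‖exp (verticalLine w)‖ = Real.exp 1 := by
  rw [norm_exp, verticalLine_re]

theorem norm_verticalLine_cpow_neg (w p : ℝ) :
    ‖verticalLine w ^ (-p : ℂ)‖ = ‖verticalLine w‖ ^ (-p) := by
  rw [← ofReal_neg, norm_cpow_real]

theorem continuous_verticalLine : Continuous verticalLine := by
  unfold verticalLine
  fun_prop

theorem continuous_verticalLine_cpow (a : ℂ) : Continuous fun w => verticalLine w ^ a :=
  continuous_verticalLine.cpow continuous_const fun w =>
    Or.inl ((verticalLine_re w).symm ▸ one_pos)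

theorem integrable_norm_verticalLine_rpow_neg {p : ℝ} (hp : 1 < p) :
    Integrable fun w => ‖verticalLine w‖ ^ (-p) := by
  have hnorm : ∀ w, ‖verticalLine w‖ = (1 + ‖2 * π * w‖ ^ 2) ^ ((1 : ℝ) / 2) := fun w => by
    rw [← Real.sqrt_eq_rpow, norm_eq_sqrt_sq_add_sq, verticalLine_re, Real.norm_eq_abs, sq_abs]
    simp [verticalLine]
  have hjapanese := (integrable_rpow_neg_one_add_norm_sq (E := ℝ) (μ := volume) (r := p)
    (by simpa using hp)).comp_mul_left' (R := 2 * π) (by positivity)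
  refine hjapanese.congr (Eventually.of_forall fun w => ?_)
  simp only [hnorm]
  rw [← Real.rpow_mul (by positivity)]
  ring_nf

theorem integrable_verticalLine_cpow_neg {p : ℝ} (hp : 1 < p) :
    Integrable fun w => verticalLine w ^ (-p : ℂ) :=
  (integrable_norm_verticalLine_rpow_neg hp).mono'
    (continuous_verticalLine_cpow _).aestronglyMeasurable
    (Eventually.of_forall fun w => (norm_verticalLine_cpow_neg w p).le)

/-- The density `t ^ (p - 1) * exp (-t)` of Euler's integral for `Γ(p)`, extended by zero to
`t ≤ 0`, so that Fourier inversion on `ℝ` applies to it. -/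
noncomputable def gammaDensity (p t : ℝ) : ℂ :=
  (Ioi 0).indicator (fun t : ℝ => (t : ℂ) ^ ((p : ℂ) - 1) * exp (-t)) t

theorem integrable_gammaDensity {p : ℝ} (hp : 0 < p) : Integrable (gammaDensity p) := by
  refine (integrable_indicator_iff measurableSet_Ioi).2 ?_
  refine (GammaIntegral_convergent (s := p) (by simpa using hp)).congr_fun (fun t _ => ?_)
    measurableSet_Ioi
  simp [mul_comm]

theorem continuousAt_gammaDensity (p : ℝ) {t : ℝ} (ht : 0 < t) :
    ContinuousAt (gammaDensity p) t := by
  have hcont : ContinuousOn (fun t : ℝ => (t : ℂ) ^ ((p : ℂ) - 1) * exp (-t)) (Ioi 0) :=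
    (continuousOn_ofReal_cpow_Ioi _).mul (by fun_prop)
  refine (hcont.continuousAt (Ioi_mem_nhds ht)).congr ?_
  filter_upwards [Ioi_mem_nhds ht] with x hx
  rw [gammaDensity, indicator_of_mem hx]

theorem fourier_gammaDensity {p : ℝ} (hp : 0 < p) :
    𝓕 (gammaDensity p) = fun w => Gamma p * verticalLine w ^ (-p : ℂ) := by
  ext w
  rw [Real.fourier_real_eq_integral_exp_smul,
    ← integral_cpow_mul_exp_neg_mul_Ioi_of_re_pos (by simpa using hp)
      ((verticalLine_re w).symm ▸ one_pos), ← integral_indicator measurableSet_Ioi]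
  congr 1 with t
  by_cases ht : t ∈ Ioi (0 : ℝ)
  · simp only [gammaDensity, indicator_of_mem ht, smul_eq_mul]
    rw [mul_left_comm, ← exp_add]
    congr 2
    push_cast [verticalLine]
    ring
  · simp [gammaDensity, indicator_of_notMem ht]

theorem inv_Gamma_eq_integral_verticalLine {p : ℝ} (hp : 1 < p) :
    (Gamma p)⁻¹ = ∫ w, exp (verticalLine w) * verticalLine w ^ (-p : ℂ) := by
  have hp₀ : 0 < p := one_pos.trans hp
  have hG : Gamma p ≠ 0 := Gamma_ne_zero_of_re_pos (by simpa using hp₀)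
  have hF : Integrable (𝓕 (gammaDensity p)) := by
    rw [fourier_gammaDensity hp₀]
    exact (integrable_verticalLine_cpow_neg hp).const_mul _
  have hinv : 𝓕⁻ (𝓕 (gammaDensity p)) 1 = exp (-1) := by
    rw [(integrable_gammaDensity hp₀).fourierInv_fourier_eq hF
      (continuousAt_gammaDensity p one_pos)]
    simp [gammaDensity]
  have hline : ∀ w, exp (verticalLine w) = exp 1 * exp (2 * π * w * I) := fun w => by
    rw [← exp_add, verticalLine]
  rw [inv_eq_iff_eq_inv, eq_comm, inv_eq_iff_eq_inv, eq_comm, ← one_div, div_eq_iff hG]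
  calc (1 : ℂ) = exp 1 * 𝓕⁻ (𝓕 (gammaDensity p)) 1 := by rw [hinv, ← exp_add]; simp
    _ = (∫ w, exp (verticalLine w) * verticalLine w ^ (-p : ℂ)) * Gamma p := by
      rw [fourier_gammaDensity hp₀, Real.fourierInv_eq', ← integral_const_mul,
        ← integral_mul_const]
      congr 1 with w
      rw [hline, show inner ℝ w 1 = w by simp, smul_eq_mul]
      push_cast
      ring

end ReciprocalGamma

section MittagLeffler

open Complex

theorem rpow_mul_exp_neg_le_Gamma {T x : ℝ} (hT : 0 < T) (hx : 1 ≤ x) :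
    T ^ (x - 1) * Real.exp (-T) ≤ Real.Gamma x := by
  have hint : IntegrableOn (fun t : ℝ => Real.exp (-t) * t ^ (x - 1)) (Ioi 0) :=
    Real.GammaIntegral_convergent (one_pos.trans_le hx)
  have hsub : Ioi T ⊆ Ioi 0 := Ioi_subset_Ioi hT.le
  rw [Real.Gamma_eq_integral (one_pos.trans_le hx), ← integral_exp_neg_Ioi, mul_comm,
    ← integral_mul_const]
  calc ∫ t in Ioi T, Real.exp (-t) * T ^ (x - 1)
      ≤ ∫ t in Ioi T, Real.exp (-t) * t ^ (x - 1) := by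
        refine setIntegral_mono_on ((integrableOn_exp_neg_Ioi T).mul_const _)
          (hint.mono_set hsub) measurableSet_Ioi fun t (ht : T < t) => ?_
        have := sub_nonneg.2 hx
        gcongr
    _ ≤ ∫ t in Ioi 0, Real.exp (-t) * t ^ (x - 1) := by
        refine setIntegral_mono_set hint ?_ hsub.eventuallyLE
        filter_upwards [ae_restrict_mem measurableSet_Ioi] with t (ht : 0 < t)
        exact mul_nonneg (Real.exp_nonneg _) (Real.rpow_nonneg ht.le _)

variable {α : ℝ}

theorem summable_pow_div_norm_Gamma (hα : 0 < α) (β R : ℝ) :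
    Summable fun n : ℕ => R ^ n / ‖Gamma ((α * n + β : ℝ) : ℂ)‖ := by
  set T := (|R| + 1) ^ α⁻¹
  have hT : 0 < T := by positivity
  have hratio : |R| / (|R| + 1) < 1 := (div_lt_one (by positivity)).2 (lt_add_one _)
  refine Summable.of_norm_bounded_eventually_nat
    ((summable_geometric_of_lt_one (by positivity) hratio).mul_right
      (T ^ (β - 1) * Real.exp (-T))⁻¹) ?_
  have hlarge : ∀ᶠ n : ℕ in atTop, 1 ≤ α * n + β :=
    (tendsto_atTop_add_const_right _ β
      (tendsto_natCast_atTop_atTop.const_mul_atTop hα)).eventually_ge_atTop 1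
  filter_upwards [hlarge] with n hn
  have hTpow : T ^ (α * n + β - 1) = (|R| + 1) ^ n * T ^ (β - 1) := by
    rw [add_sub_assoc, Real.rpow_add hT, Real.rpow_mul hT.le, Real.rpow_natCast,
      Real.rpow_inv_rpow (by positivity) hα.ne']
  have hG := rpow_mul_exp_neg_le_Gamma hT hn
  rw [hTpow, mul_assoc] at hG
  rw [Gamma_ofReal, norm_real, norm_div, norm_norm, norm_pow, Real.norm_eq_abs, div_pow,
    ← div_eq_mul_inv, div_div]
  gcongr
  exact hG.trans (Real.le_norm_self _)

theorem norm_mittagLeffler_term_le {β R : ℝ} {z : ℂ} (hz : z ∈ Metric.ball 0 R) (n : ℕ) :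
    ‖z ^ n / Gamma ((α * n + β : ℝ) : ℂ)‖ ≤ R ^ n / ‖Gamma ((α * n + β : ℝ) : ℂ)‖ := by
  rw [norm_div, norm_pow]
  gcongr
  exact (mem_ball_zero_iff.1 hz).le

theorem hasSum_mittagLeffler (hα : 0 < α) (β : ℝ) (z : ℂ) :
    HasSum (fun n : ℕ => z ^ n / Gamma ((α * n + β : ℝ) : ℂ)) (mittagLeffler α β z) :=
  (Summable.of_norm_bounded (summable_pow_div_norm_Gamma hα β (‖z‖ + 1))
    (norm_mittagLeffler_term_le (by simp))).hasSum

theorem differentiable_mittagLeffler (hα : 0 < α) (β : ℝ) :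
    Differentiable ℂ (mittagLeffler α β) := fun z =>
  (differentiableOn_tsum_of_summable_norm (summable_pow_div_norm_Gamma hα β (‖z‖ + 1))
    (fun n => by fun_prop) Metric.isOpen_ball
    fun n _ hw => norm_mittagLeffler_term_le hw n).differentiableAt
      (Metric.isOpen_ball.mem_nhds (by simp))

theorem hasSum_deriv_mittagLeffler (hα : 0 < α) (β : ℝ) (z : ℂ) :
    HasSum (fun n : ℕ => n * z ^ (n - 1) / Gamma ((α * n + β : ℝ) : ℂ))
      (deriv (mittagLeffler α β) z) := by
  have h := hasSum_deriv_of_summable_norm (summable_pow_div_norm_Gamma hα β (‖z‖ + 1))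
    (F := fun (n : ℕ) (z : ℂ) => z ^ n / Gamma ((α * n + β : ℝ) : ℂ))
    (fun n => by fun_prop) Metric.isOpen_ball (fun n _ hw => norm_mittagLeffler_term_le hw n)
    (z := z) (by simp)
  simp only [deriv_div_const, deriv_pow_field] at h
  exact h

-- Division by `Complex.Gamma` at a pole gives `0`, which is the value of the entire function `1/Γ`.
theorem mittagLeffler_eq_add_deriv (hα : 0 < α) (β : ℝ) (z : ℂ) :
    mittagLeffler α β z =
      β * mittagLeffler α (β + 1) z + α * (z * deriv (mittagLeffler α (β + 1)) z) := by
  refine (hasSum_mittagLeffler hα β z).unique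
    ((((hasSum_mittagLeffler hα (β + 1) z).mul_left (β : ℂ)).add
      (((hasSum_deriv_mittagLeffler hα (β + 1) z).mul_left z).mul_left (α : ℂ))).congr_fun
        fun n => ?_)
  have hpow : z * (n * z ^ (n - 1)) = n * z ^ n := by
    rcases n with _ | n
    · simp
    · rw [Nat.add_sub_cancel, pow_succ']
      ring
  have hG := one_div_Gamma_eq_self_mul_one_div_Gamma_add_one ((α * n + β : ℝ) : ℂ)
  rw [show ((α * n + β : ℝ) : ℂ) + 1 = ((α * n + (β + 1) : ℝ) : ℂ) by push_cast; ring] at hG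
  rw [← mul_div_assoc z, hpow, div_eq_mul_inv (z ^ n), hG]
  push_cast
  ring

-- With `r = ‖exp u‖` and `c = cos (Im u)`,
-- `2 |1 + exp u|² = (1 + r)² (1 + c) + (1 - r)² (1 - c)` and `1 + c = 2 cos² (Im u / 2)`.
theorem cos_half_im_mul_one_add_norm_exp_le (u : ℂ) :
    Real.cos (u.im / 2) * (1 + ‖exp u‖) ≤ ‖1 + exp u‖ := by
  refine le_of_abs_le (abs_le_of_sq_le_sq ?_ (norm_nonneg _))
  have hnorm : ‖1 + exp u‖ ^ 2 =
      1 + Real.exp u.re ^ 2 + 2 * Real.exp u.re * Real.cos u.im := by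
    rw [Complex.sq_norm, normSq_apply]
    simp only [add_re, one_re, exp_re, add_im, one_im, exp_im]
    linear_combination Real.exp u.re ^ 2 * Real.sin_sq_add_cos_sq u.im
  rw [hnorm, mul_pow, Real.cos_sq, mul_div_cancel₀ _ two_ne_zero, norm_exp]
  nlinarith [mul_nonneg (sq_nonneg (1 - Real.exp u.re)) (sub_nonneg.2 (Real.cos_le_one u.im))]

theorem exp_mul_verticalLine_cpow_neg (α : ℝ) (s : ℂ) (w : ℝ) :
    exp s * verticalLine w ^ (-α : ℂ) = exp (s - α * log (verticalLine w)) := by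
  rw [cpow_def_of_ne_zero (verticalLine_ne_zero w), ← exp_add]
  ring_nf

theorem cos_mul_le_norm_one_add_exp_mul_verticalLine_cpow (hα : 0 ≤ α) {ε : ℝ}
    (hαε : α * (π / 2) + ε ≤ π) {s : ℂ} (hs : |s.im| ≤ ε) (w : ℝ) :
    Real.cos ((α * (π / 2) + ε) / 2) * (1 + ‖exp s * verticalLine w ^ (-α : ℂ)‖) ≤
      ‖1 + exp s * verticalLine w ^ (-α : ℂ)‖ := by
  rw [exp_mul_verticalLine_cpow_neg]
  set u := s - α * log (verticalLine w) with hu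
  have harg : |(log (verticalLine w)).im| ≤ π / 2 := by
    rw [log_im, abs_arg_le_pi_div_two_iff, verticalLine_re]
    exact zero_le_one
  have him : |u.im| ≤ α * (π / 2) + ε := by
    rw [hu, sub_im, im_ofReal_mul]
    calc |s.im - α * (log (verticalLine w)).im|
        ≤ |s.im| + α * |(log (verticalLine w)).im| := by
          rw [← abs_of_nonneg hα, ← abs_mul, abs_of_nonneg hα]
          exact abs_sub _ _
      _ ≤ α * (π / 2) + ε := by
          rw [add_comm]
          gcongr
  refine le_trans ?_ (cos_half_im_mul_one_add_norm_exp_le u)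
  gcongr
  rw [← Real.cos_abs (u.im / 2), abs_div, abs_two]
  exact Real.cos_le_cos_of_nonneg_of_le_pi (by positivity) (by linarith [Real.pi_pos]) (by gcongr)

theorem norm_exp_mul_verticalLine_cpow_neg (α : ℝ) (s : ℂ) (w : ℝ) :
    ‖exp s * verticalLine w ^ (-α : ℂ)‖ = ‖exp s‖ * ‖verticalLine w‖ ^ (-α) := by
  rw [norm_mul, norm_verticalLine_cpow_neg]

/-- The integrand `exp t * t ^ (α - β) / (t ^ α + exp s)` of the Bromwich representation of
`E_{α,β}(-exp s)`, written on the line `t = 1 + 2πiw`. -/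
noncomputable def mittagLefflerKernel (α β : ℝ) (s : ℂ) (w : ℝ) : ℂ :=
  exp (verticalLine w) * verticalLine w ^ (-β : ℂ) / (1 + exp s * verticalLine w ^ (-α : ℂ))

theorem mittagLeffler_neg_exp_eq_integral_of_re_neg (hα : 0 < α) {β : ℝ} (hβ : 1 < β) {s : ℂ}
    (hs : s.re < 0) : mittagLeffler α β (-exp s) = ∫ w, mittagLefflerKernel α β s w := by
  have hratio : ∀ w, ‖-(exp s * verticalLine w ^ (-α : ℂ))‖ ≤ ‖exp s‖ := fun w => by
    rw [norm_neg, norm_exp_mul_verticalLine_cpow_neg]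
    exact mul_le_of_le_one_right (norm_nonneg _)
      (Real.rpow_le_one_of_one_le_of_nonpos (one_le_norm_verticalLine w) (by linarith))
  have hsum := hasSum_integral_mul_pow (g := fun w => -(exp s * verticalLine w ^ (-α : ℂ)))
    ((integrable_verticalLine_cpow_neg hβ).bdd_mul (c := Real.exp 1)
      continuous_verticalLine.cexp.aestronglyMeasurable
      (Eventually.of_forall fun w => (norm_exp_verticalLine w).le))
    (continuous_const.mul (continuous_verticalLine_cpow _)).neg.aestronglyMeasurable
    (by rwa [norm_exp, Real.exp_lt_one_iff]) hratio
  simp only [sub_neg_eq_add] at hsum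
  refine (hasSum_mittagLeffler hα β _).unique (hsum.congr_fun fun n => ?_)
  have hp : 1 < α * n + β := hβ.trans_le (le_add_of_nonneg_left (by positivity))
  rw [div_eq_mul_inv, inv_Gamma_eq_integral_verticalLine hp, ← integral_const_mul]
  congr 1 with w
  have hpow : verticalLine w ^ (-((α * n + β : ℝ) : ℂ)) =
      verticalLine w ^ (-β : ℂ) * (verticalLine w ^ (-α : ℂ)) ^ n := by
    rw [← cpow_mul_nat, ← cpow_add _ _ (verticalLine_ne_zero w)]
    push_cast
    ring_nf
  rw [hpow, ← neg_mul, mul_pow]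
  ring

theorem isOpen_strip (ε : ℝ) : IsOpen {s : ℂ | |s.im| < ε} :=
  isOpen_lt continuous_im.abs continuous_const

theorem isPreconnected_strip (ε : ℝ) : IsPreconnected {s : ℂ | |s.im| < ε} := by
  simp_rw [abs_lt]
  exact ((convex_Ioo (-ε) ε).linear_preimage imLm).isPreconnected

variable {ε : ℝ}

theorem cos_half_strip_pos (hα : 0 < α) (hε : 0 ≤ ε) (hαε : α * (π / 2) + ε < π) :
    0 < Real.cos ((α * (π / 2) + ε) / 2) :=
  Real.cos_pos_of_mem_Ioo ⟨by nlinarith [Real.pi_pos], by linarith⟩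

theorem norm_mittagLefflerKernel_le (hα : 0 < α) (hαε : α * (π / 2) + ε < π) {β : ℝ} {s : ℂ}
    (hs : |s.im| ≤ ε) (w : ℝ) :
    ‖mittagLefflerKernel α β s w‖ ≤ Real.exp 1 * ‖verticalLine w‖ ^ (-β) /
      (Real.cos ((α * (π / 2) + ε) / 2) * (1 + ‖exp s‖ * ‖verticalLine w‖ ^ (-α))) := by
  have := cos_half_strip_pos hα ((abs_nonneg _).trans hs) hαε
  have hden := cos_mul_le_norm_one_add_exp_mul_verticalLine_cpow hα.le hαε.le hs w
  rw [norm_exp_mul_verticalLine_cpow_neg] at hden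
  rw [mittagLefflerKernel, norm_div, norm_mul, norm_exp_verticalLine, norm_verticalLine_cpow_neg]
  gcongr

theorem one_add_exp_mul_verticalLine_cpow_ne_zero (hα : 0 < α)
    (hαε : α * (π / 2) + ε < π) {s : ℂ} (hs : |s.im| ≤ ε) (w : ℝ) :
    1 + exp s * verticalLine w ^ (-α : ℂ) ≠ 0 := by
  have := cos_half_strip_pos hα ((abs_nonneg _).trans hs) hαε
  have hden := cos_mul_le_norm_one_add_exp_mul_verticalLine_cpow hα.le hαε.le hs w
  exact norm_pos_iff.1 (lt_of_lt_of_le (by positivity) hden)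

theorem differentiableOn_integral_mittagLefflerKernel (hα : 0 < α)
    (hαε : α * (π / 2) + ε < π) {β : ℝ} (hβ : 1 < β) :
    DifferentiableOn ℂ (fun s => ∫ w, mittagLefflerKernel α β s w) {s | |s.im| < ε} := by
  refine differentiableOn_integral_of_dominated (isOpen_strip ε)
    (b := fun w => Real.exp 1 * ‖verticalLine w‖ ^ (-β) / Real.cos ((α * (π / 2) + ε) / 2))
    (fun s (hs : |s.im| < ε) => ?_) (Eventually.of_forall fun w s (hs : |s.im| < ε) => ?_)
    (Eventually.of_forall fun w s (hs : |s.im| < ε) => ?_)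
    (((integrable_norm_verticalLine_rpow_neg hβ).const_mul _).div_const _)
  · exact (Continuous.div (continuous_verticalLine.cexp.mul (continuous_verticalLine_cpow _))
      (continuous_const.add (continuous_const.mul (continuous_verticalLine_cpow _)))
      (one_add_exp_mul_verticalLine_cpow_ne_zero hα hαε hs.le)).aestronglyMeasurable
  · exact (DifferentiableAt.fun_div (by fun_prop)
      ((differentiableAt_const _).add (differentiableAt_exp.mul_const _))
      (one_add_exp_mul_verticalLine_cpow_ne_zero hα hαε hs.le w)).differentiableWithinAt
  · have hcos := cos_half_strip_pos hα ((abs_nonneg _).trans hs.le) hαε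
    refine (norm_mittagLefflerKernel_le hα hαε hs.le w).trans ?_
    gcongr
    exact le_mul_of_one_le_right hcos.le (le_add_of_nonneg_right (by positivity))

theorem mittagLeffler_neg_exp_eq_integral (hα : 0 < α) (hαε : α * (π / 2) + ε < π)
    {β : ℝ} (hβ : 1 < β) {s : ℂ} (hs : |s.im| < ε) :
    mittagLeffler α β (-exp s) = ∫ w, mittagLefflerKernel α β s w := by
  have hE : DifferentiableOn ℂ (fun s => mittagLeffler α β (-exp s)) {s | |s.im| < ε} :=
    ((differentiable_mittagLeffler hα β).comp differentiable_exp.neg).differentiableOn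
  have hK := differentiableOn_integral_mittagLefflerKernel hα hαε hβ
  refine (hE.analyticOnNhd (isOpen_strip ε)).eqOn_of_preconnected_of_eventuallyEq
    (hK.analyticOnNhd (isOpen_strip ε)) (isPreconnected_strip ε) (z₀ := -1)
    (by simpa using (abs_nonneg _).trans_lt hs) ?_ hs
  filter_upwards [(isOpen_lt continuous_re continuous_const).mem_nhds
    (show (-1 : ℂ).re < 0 by simp)] with z hz
  exact mittagLeffler_neg_exp_eq_integral_of_re_neg hα hβ hz

theorem exists_one_add_norm_exp_mul_norm_mittagLeffler_le_of_add_one_lt (hα : 0 < α)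
    (hα₂ : α < 2) {β : ℝ} (hβ : α + 1 < β) :
    ∃ ε > 0, ∃ C, ∀ s : ℂ, |s.im| < ε →
      (1 + ‖exp s‖) * ‖mittagLeffler α β (-exp s)‖ ≤ C := by
  set ε := π * (2 - α) / 4 with hε_def
  have hε : 0 < ε := by have := sub_pos.2 hα₂; positivity
  have hαε : α * (π / 2) + ε < π := by nlinarith [Real.pi_pos]
  set c := Real.cos ((α * (π / 2) + ε) / 2)
  have hc : 0 < c := cos_half_strip_pos hα hε.le hαε
  refine ⟨ε, hε, ∫ w, Real.exp 1 * ‖verticalLine w‖ ^ (-(β - α)) / c, fun s hs => ?_⟩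
  rw [← le_div_iff₀' (by positivity), mittagLeffler_neg_exp_eq_integral hα hαε (by linarith) hs,
    ← integral_div]
  refine norm_integral_le_of_norm_le ((((integrable_norm_verticalLine_rpow_neg
    (by linarith)).const_mul _).div_const _).div_const _) (Eventually.of_forall fun w => ?_)
  refine (norm_mittagLefflerKernel_le hα hαε hs.le w).trans ?_
  have hT : 0 < ‖verticalLine w‖ := one_pos.trans_le (one_le_norm_verticalLine w)
  have hTα : 1 ≤ ‖verticalLine w‖ ^ α := Real.one_le_rpow (one_le_norm_verticalLine w) hα.le
  have hsplit : ‖verticalLine w‖ ^ (-(β - α)) = ‖verticalLine w‖ ^ (-β) * ‖verticalLine w‖ ^ α := by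
    rw [← Real.rpow_add hT]
    ring_nf
  have hnum : 1 + ‖exp s‖ ≤
      ‖verticalLine w‖ ^ α * (1 + ‖exp s‖ * ‖verticalLine w‖ ^ (-α)) := by
    rw [Real.rpow_neg hT.le, mul_add, mul_one, mul_left_comm, mul_inv_cancel₀ (by positivity),
      mul_one]
    gcongr
  rw [div_div, div_le_div_iff₀ (by positivity) (by positivity), hsplit]
  calc Real.exp 1 * ‖verticalLine w‖ ^ (-β) * (c * (1 + ‖exp s‖))
      ≤ Real.exp 1 * ‖verticalLine w‖ ^ (-β) *
        (c * (‖verticalLine w‖ ^ α * (1 + ‖exp s‖ * ‖verticalLine w‖ ^ (-α)))) := by gcongr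
    _ = _ := by ring

theorem abs_im_lt_of_mem_sphere {s z : ℂ} {ε : ℝ} (hs : |s.im| < ε / 2)
    (hz : z ∈ Metric.sphere s (ε / 2)) : |z.im| < ε := by
  have him : |z.im - s.im| ≤ ε / 2 := by
    rw [← mem_sphere_iff_norm.1 hz, ← sub_im]
    exact abs_im_le_norm _
  linarith [abs_sub_abs_le_abs_sub z.im s.im]

theorem one_add_norm_exp_mul_norm_deriv_le {K : ℂ → ℂ} (hK : Differentiable ℂ K) {C : ℝ}
    (hε : 0 < ε) (hC : ∀ s : ℂ, |s.im| < ε → (1 + ‖exp s‖) * ‖K s‖ ≤ C) {s : ℂ}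
    (hs : |s.im| < ε / 2) :
    (1 + ‖exp s‖) * ‖deriv K s‖ ≤ Real.exp (ε / 2) * C / (ε / 2) := by
  rw [← le_div_iff₀' (by positivity), div_right_comm]
  refine norm_deriv_le_of_forall_mem_sphere_norm_le (by positivity) hK.diffContOnCl fun z hz => ?_
  rw [le_div_iff₀' (by positivity)]
  have hre : s.re ≤ ε / 2 + z.re := by
    have := (neg_abs_le _).trans' (neg_le_neg (abs_re_le_norm (z - s)))
    rw [mem_sphere_iff_norm.1 hz, sub_re] at this
    linarith
  have hexp : 1 + ‖exp s‖ ≤ Real.exp (ε / 2) * (1 + ‖exp z‖) := by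
    rw [norm_exp, norm_exp, mul_add, mul_one, ← Real.exp_add]
    gcongr
    exact Real.one_le_exp (by positivity)
  calc (1 + ‖exp s‖) * ‖K z‖ ≤ Real.exp (ε / 2) * (1 + ‖exp z‖) * ‖K z‖ := by gcongr
    _ ≤ Real.exp (ε / 2) * C := by
      rw [mul_assoc]
      gcongr
      exact hC z (abs_im_lt_of_mem_sphere hs hz)

theorem exists_one_add_norm_exp_mul_norm_mittagLeffler_le (hα : 0 < α) (hα₂ : α < 2) (β : ℝ) :
    ∃ ε > 0, ∃ C, ∀ s : ℂ, |s.im| < ε →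
      (1 + ‖exp s‖) * ‖mittagLeffler α β (-exp s)‖ ≤ C := by
  obtain ⟨m, hm⟩ := exists_nat_gt (α + 1 - β)
  induction m generalizing β with
  | zero =>
    exact exists_one_add_norm_exp_mul_norm_mittagLeffler_le_of_add_one_lt hα hα₂
      (by simpa [sub_neg] using hm)
  | succ m ih =>
    obtain ⟨ε, hε, C, hC⟩ := ih (β + 1) (by push_cast at hm; linarith)
    let K : ℂ → ℂ := fun s => mittagLeffler α (β + 1) (-exp s)
    have hE := differentiable_mittagLeffler hα (β + 1)
    have hK : Differentiable ℂ K := hE.comp differentiable_exp.neg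
    have hEK : ∀ s, mittagLeffler α β (-exp s) = β * K s + α * deriv K s := fun s => by
      have hKs : HasDerivAt K (deriv (mittagLeffler α (β + 1)) (-exp s) * -exp s) s :=
        (hE _).hasDerivAt.comp s (hasDerivAt_exp s).neg
      rw [mittagLeffler_eq_add_deriv hα, hKs.deriv, mul_comm (-exp s)]
    refine ⟨ε / 2, by positivity, |β| * C + α * (Real.exp (ε / 2) * C / (ε / 2)), fun s hs => ?_⟩
    calc (1 + ‖exp s‖) * ‖mittagLeffler α β (-exp s)‖
        ≤ (1 + ‖exp s‖) * (|β| * ‖K s‖ + α * ‖deriv K s‖) := by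
          rw [hEK]
          gcongr
          exact (norm_add_le _ _).trans_eq (by simp [abs_of_pos hα])
      _ = |β| * ((1 + ‖exp s‖) * ‖K s‖) + α * ((1 + ‖exp s‖) * ‖deriv K s‖) := by ring
      _ ≤ _ := by
          gcongr
          · exact hC s (by linarith)
          · exact one_add_norm_exp_mul_norm_deriv_le hK hε hC hs

theorem iteratedDeriv_comp_ofReal {f : ℂ → ℂ} (hf : Differentiable ℂ f) (n : ℕ) :
    iteratedDeriv n (fun x : ℝ => f x) = fun x : ℝ => iteratedDeriv n f x := by
  induction n with
  | zero => simp
  | succ n ih =>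
    ext x
    rw [iteratedDeriv_succ, ih, iteratedDeriv_succ]
    exact ((hf.contDiff (n := ∞)).differentiable_iteratedDeriv n
      (by exact_mod_cast WithTop.coe_lt_top n) x).hasDerivAt.comp_ofReal.deriv

theorem norm_iteratedFDeriv_comp_ofReal_le {f : ℂ → ℂ} (hf : Differentiable ℂ f) {C : ℝ}
    (hε : 0 < ε) (hC : ∀ s : ℂ, |s.im| < ε → ‖f s‖ ≤ C) (n : ℕ) (x : ℝ) :
    ‖iteratedFDeriv ℝ n (fun x : ℝ => f x) x‖ ≤ n ! * C / (ε / 2) ^ n := by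
  rw [norm_iteratedFDeriv_eq_norm_iteratedDeriv, iteratedDeriv_comp_ofReal hf]
  exact norm_iteratedDeriv_le_of_forall_mem_sphere_norm_le n (by positivity) hf.diffContOnCl
    fun z hz => hC z (abs_im_lt_of_mem_sphere (by simpa using half_pos hε) hz)

/-- The function `x ↦ exp (τ x) E_{α,β}(-exp x)`: the Mittag-Leffler function on the negative
half-line in the logarithmic variable, with the weight `|z| ^ τ`. -/
noncomputable def logMittagLeffler (α β τ x : ℝ) : ℂ :=
  exp (τ * x) * mittagLeffler α β (-exp x)

theorem differentiable_exp_mul_mittagLeffler_neg_exp (hα : 0 < α) (β τ : ℝ) :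
    Differentiable ℂ fun s : ℂ => exp (τ * s) * mittagLeffler α β (-exp s) :=
  (by fun_prop : Differentiable ℂ fun s : ℂ => exp (τ * s)).mul
    ((differentiable_mittagLeffler hα β).comp differentiable_exp.neg)

theorem contDiff_logMittagLeffler (hα : 0 < α) (β τ : ℝ) :
    ContDiff ℝ ∞ (logMittagLeffler α β τ) :=
  ((differentiable_exp_mul_mittagLeffler_neg_exp hα β τ).contDiff.restrict_scalars ℝ).comp
    ofRealCLM.contDiff

theorem exists_norm_iteratedFDeriv_logMittagLeffler_le (hα : 0 < α) (hα₂ : α < 2) (β : ℝ)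
    (m : ℕ) :
    ∃ C, ∀ τ ∈ Icc (0 : ℝ) 1, ∀ i ≤ m, ∀ x : ℝ,
      ‖iteratedFDeriv ℝ i (logMittagLeffler α β τ) x‖ ≤ C := by
  obtain ⟨ε, hε, C, hC⟩ := exists_one_add_norm_exp_mul_norm_mittagLeffler_le hα hα₂ β
  have hbound : ∀ τ ∈ Icc (0 : ℝ) 1, ∀ s : ℂ, |s.im| < ε →
      ‖exp (τ * s) * mittagLeffler α β (-exp s)‖ ≤ C := fun τ hτ s hs => by
    refine le_trans ?_ (hC s hs)
    rw [norm_mul]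
    gcongr
    rw [norm_exp, re_ofReal_mul, norm_exp]
    rcases le_total 0 s.re with h | h
    · have := Real.exp_le_exp.2 (mul_le_of_le_one_left h hτ.2)
      linarith
    · have := Real.exp_le_one_iff.2 (mul_nonpos_of_nonneg_of_nonpos hτ.1 h)
      linarith [Real.exp_pos s.re]
  obtain ⟨M, hM⟩ :=
    ((Finset.range (m + 1)).image fun i => (i ! * C / (ε / 2) ^ i : ℝ)).exists_le
  exact ⟨M, fun τ hτ i hi x => (norm_iteratedFDeriv_comp_ofReal_le
    (differentiable_exp_mul_mittagLeffler_neg_exp hα β τ) hε (hbound τ hτ) i x).trans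
      (hM _ (Finset.mem_image_of_mem _ (Finset.mem_range_succ_iff.2 hi)))⟩

end MittagLeffler

section MultiIndex

variable {N : ℕ} {F : Type*} [NormedAddCommGroup F] [NormedSpace ℝ F]
  {U : Set (EuclideanSpace ℝ (Fin N))} {f : EuclideanSpace ℝ (Fin N) → F}

theorem partialDeriv_eqOn_fderivWithin (hU : IsOpen U) (hf : DifferentiableOn ℝ f U) (i : Fin N) :
    EqOn (partialDeriv i f) (fun ξ => fderivWithin ℝ f U ξ (EuclideanSpace.single i 1)) U := by
  intro ξ hξ
  have hd : DifferentiableAt ℝ f ξ := hf.differentiableAt (hU.mem_nhds hξ)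
  simp only [partialDeriv, hd.lineDeriv_eq_fderiv, fderivWithin_of_isOpen hU hξ]

theorem contDiffOn_partialDeriv (hU : IsOpen U) (hf : ContDiffOn ℝ ∞ f U) (i : Fin N) :
    ContDiffOn ℝ ∞ (partialDeriv i f) U :=
  ((hf.fderivWithin hU.uniqueDiffOn (m := ∞) (by simp)).clm_apply contDiffOn_const).congr
    (partialDeriv_eqOn_fderivWithin hU (hf.differentiableOn (by simp)) i)

theorem norm_iteratedFDerivWithin_partialDeriv_le (hU : IsOpen U) (hf : ContDiffOn ℝ ∞ f U)
    (i : Fin N) (n : ℕ) {ξ : EuclideanSpace ℝ (Fin N)} (hξ : ξ ∈ U) :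
    ‖iteratedFDerivWithin ℝ n (partialDeriv i f) U ξ‖ ≤
      ‖iteratedFDerivWithin ℝ (n + 1) f U ξ‖ := by
  have hfd : ContDiffOn ℝ ∞ (fderivWithin ℝ f U) U :=
    hf.fderivWithin hU.uniqueDiffOn (m := ∞) (by simp)
  rw [iteratedFDerivWithin_congr
    (partialDeriv_eqOn_fderivWithin hU (hf.differentiableOn (by simp)) i) hξ,
    ← norm_iteratedFDerivWithin_fderivWithin hU.uniqueDiffOn hξ]
  simpa using norm_iteratedFDerivWithin_clm_apply_const (c := EuclideanSpace.single i (1 : ℝ))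
    (hfd ξ hξ) hU.uniqueDiffOn hξ (n := n) (by exact_mod_cast le_top)

theorem contDiffOn_iterate_partialDeriv (hU : IsOpen U) (hf : ContDiffOn ℝ ∞ f U) (i : Fin N)
    (m : ℕ) : ContDiffOn ℝ ∞ ((partialDeriv i)^[m] f) U := by
  induction m with
  | zero => exact hf
  | succ m ih =>
    rw [Function.iterate_succ_apply']
    exact contDiffOn_partialDeriv hU ih i

theorem norm_iteratedFDerivWithin_iterate_partialDeriv_le (hU : IsOpen U)
    (hf : ContDiffOn ℝ ∞ f U) (i : Fin N) (m n : ℕ) {ξ : EuclideanSpace ℝ (Fin N)} (hξ : ξ ∈ U) :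
    ‖iteratedFDerivWithin ℝ n ((partialDeriv i)^[m] f) U ξ‖ ≤
      ‖iteratedFDerivWithin ℝ (n + m) f U ξ‖ := by
  induction m generalizing n with
  | zero => rfl
  | succ m ih =>
    rw [Function.iterate_succ_apply', ← add_assoc, add_right_comm]
    exact (norm_iteratedFDerivWithin_partialDeriv_le hU
      (contDiffOn_iterate_partialDeriv hU hf i m) i n hξ).trans (ih (n + 1))

theorem contDiffOn_foldr_partialDeriv (hU : IsOpen U) (hf : ContDiffOn ℝ ∞ f U) (γ : Fin N → ℕ)
    (l : List (Fin N)) :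
    ContDiffOn ℝ ∞ (l.foldr (fun i g => (partialDeriv i)^[γ i] g) f) U := by
  induction l with
  | nil => exact hf
  | cons i l ih => exact contDiffOn_iterate_partialDeriv hU ih i (γ i)

theorem norm_iteratedFDerivWithin_foldr_partialDeriv_le (hU : IsOpen U)
    (hf : ContDiffOn ℝ ∞ f U) (γ : Fin N → ℕ) (l : List (Fin N)) (n : ℕ)
    {ξ : EuclideanSpace ℝ (Fin N)} (hξ : ξ ∈ U) :
    ‖iteratedFDerivWithin ℝ n (l.foldr (fun i g => (partialDeriv i)^[γ i] g) f) U ξ‖ ≤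
      ‖iteratedFDerivWithin ℝ (n + (l.map γ).sum) f U ξ‖ := by
  induction l generalizing n with
  | nil => rfl
  | cons i l ih =>
    rw [List.map_cons, List.sum_cons, ← add_assoc]
    exact (norm_iteratedFDerivWithin_iterate_partialDeriv_le hU
      (contDiffOn_foldr_partialDeriv hU hf γ l) i (γ i) n hξ).trans (ih (n + γ i))

theorem norm_multiDeriv_le (hU : IsOpen U) (hf : ContDiffOn ℝ ∞ f U) (γ : Fin N → ℕ)
    {ξ : EuclideanSpace ℝ (Fin N)} (hξ : ξ ∈ U) :
    ‖multiDeriv γ f ξ‖ ≤ ‖iteratedFDerivWithin ℝ (multiLength γ) f U ξ‖ := by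
  have h := norm_iteratedFDerivWithin_foldr_partialDeriv_le hU hf γ (List.finRange N) 0 hξ
  rwa [norm_iteratedFDerivWithin_zero, zero_add, ← Fin.sum_univ_def] at h

theorem foldr_partialDeriv_single (f : EuclideanSpace ℝ (Fin N) → F) (i₀ : Fin N) (m : ℕ)
    {l : List (Fin N)} (hl : l.Nodup) :
    l.foldr (fun i g => (partialDeriv i)^[Pi.single (M := fun _ => ℕ) i₀ m i] g) f =
      if i₀ ∈ l then (partialDeriv i₀)^[m] f else f := by
  induction l with
  | nil => simp
  | cons i l ih =>
    rw [List.nodup_cons] at hl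
    rw [List.foldr_cons, ih hl.2]
    by_cases h : i = i₀
    · subst h
      simp [hl.1]
    · simp [Ne.symm h]

theorem multiDeriv_single (f : EuclideanSpace ℝ (Fin N) → F) (i : Fin N) (m : ℕ) :
    multiDeriv (Pi.single i m) f = (partialDeriv i)^[m] f := by
  simpa [multiDeriv] using foldr_partialDeriv_single f i m (List.nodup_finRange N)

theorem multiLength_single (i : Fin N) (m : ℕ) : multiLength (Pi.single i m) = m := by
  simp [multiLength]

theorem iterate_partialDeriv_smul_single (f : EuclideanSpace ℝ (Fin N) → F) (i : Fin N) (m : ℕ)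
    (t : ℝ) :
    (partialDeriv i)^[m] f (t • EuclideanSpace.single i (1 : ℝ)) =
      iteratedDeriv m (fun s : ℝ => f (s • EuclideanSpace.single i (1 : ℝ))) t := by
  induction m generalizing t with
  | zero => simp
  | succ m ih =>
    rw [Function.iterate_succ_apply', iteratedDeriv_succ]
    simp only [partialDeriv, lineDeriv, ← add_smul, ih]
    rw [deriv_comp_const_add, add_zero]

end MultiIndex

section DegreeBound

variable {N : ℕ} {k : ℝ} {σ : EuclideanSpace ℝ (Fin N) → ℝ}

theorem HomogeneousOfDegree.iterate_partialDeriv_single (hσ : HomogeneousOfDegree k σ) (i : Fin N)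
    (m : ℕ) :
    (partialDeriv i)^[m] σ (EuclideanSpace.single i 1) =
      (descPochhammer ℝ m).eval k * σ (EuclideanSpace.single i 1) := by
  have hray : (fun s : ℝ => σ (s • EuclideanSpace.single i (1 : ℝ))) =ᶠ[𝓝 1]
      fun s => s ^ k * σ (EuclideanSpace.single i 1) := by
    filter_upwards [Ioi_mem_nhds one_pos] with s hs
    exact hσ s hs _ (by simp)
  have h := iterate_partialDeriv_smul_single σ i m 1
  rwa [one_smul, hray.iteratedDeriv_eq, iteratedDeriv_mul_const_field, iteratedDeriv_eq_iterate,
    Real.iter_deriv_rpow_const, Real.one_rpow, mul_one] at h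

theorem one_add_pow_le_descPochhammer_eval (m : ℕ) (hk : m ≤ k) :
    (1 + k) ^ m ≤ (m + 1) ^ m * (descPochhammer ℝ m).eval k := by
  calc (1 + k) ^ m ≤ ((m + 1) * (k - m + 1)) ^ m := by
        have hk₀ : 0 ≤ k := m.cast_nonneg.trans hk
        gcongr
        nlinarith [mul_nonneg m.cast_nonneg (sub_nonneg.2 hk)]
    _ = (m + 1) ^ m * (k - m + 1) ^ m := mul_pow _ _ _
    _ ≤ (m + 1) ^ m * (descPochhammer ℝ m).eval k := by
        gcongr
        exact pow_le_descPochhammer_eval (by linarith)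

theorem SymbolBound.one_add_pow_mul_le {A : ℝ} (hA : SymbolBound k A σ) (hk : 0 ≤ k)
    (hσ : HomogeneousOfDegree k σ) (i : Fin N) (hpos : 0 ≤ σ (EuclideanSpace.single i 1)) :
    (1 + k) ^ (N / 2 + 1) * σ (EuclideanSpace.single i 1) ≤
      ((N / 2 + 1 : ℕ) + 1) ^ (N / 2 + 1) * A := by
  have hderiv (m : ℕ) (hm : m ≤ N / 2 + 1) :
      (descPochhammer ℝ m).eval k * σ (EuclideanSpace.single i 1) ≤ A := by
    have h := hA (Pi.single i m) (by rwa [multiLength_single]) (EuclideanSpace.single i 1) (by simp)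
    rw [multiDeriv_single, hσ.iterate_partialDeriv_single] at h
    simpa using (le_abs_self _).trans h
  rcases le_total k (N / 2 + 1 : ℕ) with hle | hge
  · have h₀ := hderiv 0 (Nat.zero_le _)
    rw [descPochhammer_zero, Polynomial.eval_one, one_mul] at h₀
    rw [add_comm 1 k]
    gcongr
  · calc (1 + k) ^ (N / 2 + 1) * σ (EuclideanSpace.single i 1)
        ≤ ((N / 2 + 1 : ℕ) + 1) ^ (N / 2 + 1) * (descPochhammer ℝ (N / 2 + 1)).eval k *
            σ (EuclideanSpace.single i 1) :=
          mul_le_mul_of_nonneg_right (one_add_pow_le_descPochhammer_eval _ hge) hpos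
      _ ≤ ((N / 2 + 1 : ℕ) + 1) ^ (N / 2 + 1) * A := by
          rw [mul_assoc]
          gcongr
          exact hderiv _ le_rfl

end DegreeBound

section Calculus

variable {E F : Type*} [NormedAddCommGroup E] [NormedSpace ℝ E] [NormedAddCommGroup F]
  [NormedSpace ℝ F]

theorem norm_iteratedFDerivWithin_comp_smul_le (f : E → F) {r : ℝ} (hr : 0 < r) {ξ : E}
    (hξ : ξ ≠ 0) (n : ℕ) :
    ‖iteratedFDerivWithin ℝ n (fun η => f (r • η)) {0}ᶜ ξ‖ ≤
      ‖iteratedFDerivWithin ℝ n f {0}ᶜ (r • ξ)‖ * r ^ n := by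
  let g : E ≃L[ℝ] E := ContinuousLinearEquiv.smulLeft (Units.mk0 r hr.ne')
  have hg : ‖(g : E →L[ℝ] E)‖ ≤ r :=
    ContinuousLinearMap.opNorm_le_bound _ hr.le fun η => by
      simp [g, Units.smul_def, norm_smul, abs_of_pos hr]
  have hpre : g ⁻¹' {0}ᶜ = {0}ᶜ := by
    ext η
    simp
  have h := g.iteratedFDerivWithin_comp_right f (s := {0}ᶜ) isOpen_compl_singleton.uniqueDiffOn
    (x := ξ) (by simpa using hξ) n
  rw [hpre] at h
  change ‖iteratedFDerivWithin ℝ n (f ∘ g) {0}ᶜ ξ‖ ≤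
    ‖iteratedFDerivWithin ℝ n f {0}ᶜ (g ξ)‖ * r ^ n
  rw [h]
  refine (ContinuousMultilinearMap.norm_compContinuousLinearMap_le _ _).trans ?_
  rw [Finset.prod_const, Finset.card_univ, Fintype.card_fin]
  gcongr

theorem exists_norm_iteratedFDerivWithin_le_of_isCompact {U K : Set E} (hU : IsOpen U)
    (hK : IsCompact K) (hKU : K ⊆ U) {f : E → F} (hf : ContDiffOn ℝ ∞ f U) (m : ℕ) :
    ∃ B, ∀ i ≤ m, ∀ x ∈ K, ‖iteratedFDerivWithin ℝ i f U x‖ ≤ B := by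
  have hbound (i : ℕ) : ∃ B, ∀ x ∈ K, ‖iteratedFDerivWithin ℝ i f U x‖ ≤ B :=
    hK.exists_bound_of_continuousOn ((hf.continuousOn_iteratedFDerivWithin
      (by exact_mod_cast le_top) hU.uniqueDiffOn).mono hKU)
  choose B hB using hbound
  obtain ⟨B', hB'⟩ := ((Finset.range (m + 1)).image B).exists_le
  exact ⟨B', fun i hi x hx => (hB i x hx).trans
    (hB' _ (Finset.mem_image_of_mem B (Finset.mem_range_succ_iff.2 hi)))⟩

theorem norm_iteratedFDerivWithin_le_of_smul_eq_add_const {f : E → F}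
    (hf : ContDiffOn ℝ ∞ f {0}ᶜ) {r : ℝ} (hr : 0 < r) {c : F}
    (hfr : ∀ ξ ≠ 0, f (r • ξ) = f ξ + c) {j : ℕ} (hj : j ≠ 0) {ξ : E} (hξ : ξ ≠ 0) :
    ‖iteratedFDerivWithin ℝ j f {0}ᶜ ξ‖ ≤ ‖iteratedFDerivWithin ℝ j f {0}ᶜ (r • ξ)‖ * r ^ j := by
  have huniq : UniqueDiffOn ℝ ({0}ᶜ : Set E) := isOpen_compl_singleton.uniqueDiffOn
  have heq : iteratedFDerivWithin ℝ j (fun η => f (r • η)) {0}ᶜ ξ =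
      iteratedFDerivWithin ℝ j f {0}ᶜ ξ := by
    have hadd : EqOn (fun η => f (r • η)) (f + fun _ => c) {0}ᶜ := hfr
    rw [iteratedFDerivWithin_congr hadd hξ, iteratedFDerivWithin_add_apply
      ((hf ξ hξ).of_le (by exact_mod_cast le_top)) contDiffWithinAt_const huniq hξ,
      iteratedFDerivWithin_const_of_ne hj]
    simp
  rw [← heq]
  exact norm_iteratedFDerivWithin_comp_smul_le f hr hξ j

theorem exists_norm_iteratedFDerivWithin_le_mul_norm_inv_pow [FiniteDimensional ℝ E] {f : E → F}
    (hf : ContDiffOn ℝ ∞ f {0}ᶜ)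
    (hdil : ∀ r : ℝ, 0 < r → ∃ c, ∀ ξ ≠ 0, f (r • ξ) = f ξ + c) (m : ℕ) :
    ∃ B, ∀ j ≤ m, j ≠ 0 → ∀ ξ ≠ 0, ‖iteratedFDerivWithin ℝ j f {0}ᶜ ξ‖ ≤ B * ‖ξ‖⁻¹ ^ j := by
  have hsphere : Metric.sphere (0 : E) 1 ⊆ {0}ᶜ := fun u hu => ne_zero_of_mem_unit_sphere ⟨u, hu⟩
  have := FiniteDimensional.proper_real E
  obtain ⟨B, hB⟩ := exists_norm_iteratedFDerivWithin_le_of_isCompact isOpen_compl_singleton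
    (isCompact_sphere (0 : E) 1) hsphere hf m
  refine ⟨B, fun j hjm hj ξ hξ => ?_⟩
  have hr : 0 < ‖ξ‖⁻¹ := inv_pos.2 (norm_pos_iff.2 hξ)
  obtain ⟨c, hc⟩ := hdil _ hr
  refine (norm_iteratedFDerivWithin_le_of_smul_eq_add_const hf hr hc hj hξ).trans ?_
  gcongr
  exact hB j hjm _ (by simp [norm_smul, norm_ne_zero_iff.2 hξ])

theorem norm_iteratedFDeriv_exp_neg_mul_le {τ : ℝ} (hτ : τ ∈ Icc (0 : ℝ) 1) (i : ℕ) (x : ℝ) :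
    ‖iteratedFDeriv ℝ i (fun y => Real.exp (-τ * y)) x‖ ≤ Real.exp |x| := by
  have hpow : τ ^ i ≤ 1 := pow_le_one₀ hτ.1 hτ.2
  have hexp : -τ * x ≤ |x| := by
    nlinarith [neg_abs_le x, abs_nonneg x, hτ.1, hτ.2]
  rw [norm_iteratedFDeriv_eq_norm_iteratedDeriv, iteratedDeriv_exp_const_mul, norm_mul, norm_pow,
    norm_neg, Real.norm_of_nonneg hτ.1, Real.norm_of_nonneg (Real.exp_pos _).le]
  calc τ ^ i * Real.exp (-τ * x) ≤ 1 * Real.exp |x| := by gcongr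
    _ = Real.exp |x| := one_mul _

variable {s : Set E} {x : E} {a b d : ℝ} {n : ℕ}

theorem norm_iteratedFDerivWithin_smul_le_of_factorial_bounds {f : E → ℝ} {g : E → F}
    (hf : ContDiffOn ℝ ∞ f s) (hg : ContDiffOn ℝ ∞ g s) (hs : UniqueDiffOn ℝ s) (hx : x ∈ s)
    (hfa : ∀ i ≤ n, ‖iteratedFDerivWithin ℝ i f s x‖ ≤ i ! * a * d ^ i)
    (hgb : ∀ i ≤ n, ‖iteratedFDerivWithin ℝ i g s x‖ ≤ i ! * b * d ^ i) :
    ‖iteratedFDerivWithin ℝ n (fun y => f y • g y) s x‖ ≤ (n + 1)! * a * b * d ^ n := by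
  calc ‖iteratedFDerivWithin ℝ n (fun y => f y • g y) s x‖
      ≤ ∑ i ∈ Finset.range (n + 1), (n.choose i : ℝ) * ‖iteratedFDerivWithin ℝ i f s x‖ *
          ‖iteratedFDerivWithin ℝ (n - i) g s x‖ :=
        norm_iteratedFDerivWithin_smul_le hf hg hs hx (by exact_mod_cast le_top)
    _ ≤ ∑ _i ∈ Finset.range (n + 1), (n ! : ℝ) * a * b * d ^ n := by
        refine Finset.sum_le_sum fun i hi => ?_
        have hin : i ≤ n := Finset.mem_range_succ_iff.1 hi
        calc (n.choose i : ℝ) * ‖iteratedFDerivWithin ℝ i f s x‖ *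
              ‖iteratedFDerivWithin ℝ (n - i) g s x‖
            ≤ (n.choose i : ℝ) * (i ! * a * d ^ i) * ((n - i)! * b * d ^ (n - i)) := by
              have := (norm_nonneg _).trans (hfa i hin)
              gcongr
              exacts [hfa i hin, hgb (n - i) (Nat.sub_le n i)]
          _ = ((n.choose i * i ! * (n - i)! : ℕ) : ℝ) * a * b * (d ^ i * d ^ (n - i)) := by
              push_cast
              ring
          _ = (n ! : ℝ) * a * b * d ^ n := by
              rw [Nat.choose_mul_factorial_mul_factorial hin, ← pow_add, Nat.add_sub_cancel' hin]
    _ = (n + 1)! * a * b * d ^ n := by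
        rw [Finset.sum_const, Finset.card_range, nsmul_eq_mul, Nat.factorial_succ]
        push_cast
        ring

theorem norm_iteratedFDerivWithin_exp_smul_comp_le {u v : E → ℝ} {G : ℝ → F}
    (hu : ContDiffOn ℝ ∞ u s) (hv : ContDiffOn ℝ ∞ v s) (hG : ContDiff ℝ ∞ G)
    (hs : UniqueDiffOn ℝ s) (hx : x ∈ s) {τ B C : ℝ} (hτ : τ ∈ Icc (0 : ℝ) 1) (hux : |u x| ≤ B)
    (hud : ∀ j ≤ n, j ≠ 0 → ‖iteratedFDerivWithin ℝ j u s x‖ ≤ d ^ j)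
    (hvd : ∀ j ≤ n, j ≠ 0 → ‖iteratedFDerivWithin ℝ j v s x‖ ≤ d ^ j)
    (hGC : ∀ j ≤ n, ‖iteratedFDeriv ℝ j G (v x)‖ ≤ C) :
    ‖iteratedFDerivWithin ℝ n (fun y => Real.exp (-τ * u y) • G (v y)) s x‖ ≤
      (n + 1)! * Real.exp B * C * d ^ n := by
  have hexp : ContDiff ℝ ∞ fun y : ℝ => Real.exp (-τ * y) := by fun_prop
  refine norm_iteratedFDerivWithin_smul_le_of_factorial_bounds (hexp.comp_contDiffOn hu)
    (hG.comp_contDiffOn hv) hs hx (fun i hi => ?_) fun i hi => ?_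
  · refine norm_iteratedFDerivWithin_comp_le hexp.contDiffOn hu (by exact_mod_cast le_top)
      uniqueDiffOn_univ hs (mapsTo_univ _ _) hx (fun j _ => ?_) fun j hj hji =>
        hud j (hji.trans hi) (by omega)
    rw [iteratedFDerivWithin_univ]
    exact (norm_iteratedFDeriv_exp_neg_mul_le hτ j _).trans (Real.exp_le_exp.2 hux)
  · refine norm_iteratedFDerivWithin_comp_le hG.contDiffOn hv (by exact_mod_cast le_top)
      uniqueDiffOn_univ hs (mapsTo_univ _ _) hx (fun j hj => ?_) fun j hj hji =>
        hvd j (hji.trans hi) (by omega)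
    rw [iteratedFDerivWithin_univ]
    exact hGC j (hj.trans hi)

end Calculus

section LogAngular

variable {E : Type*} [NormedAddCommGroup E] [InnerProductSpace ℝ E] {σ : E → ℝ}

theorem contDiffOn_log_norm : ContDiffOn ℝ ∞ (fun ξ : E => Real.log ‖ξ‖) {0}ᶜ :=
  (contDiffOn_id.norm ℝ fun _ hξ => hξ).log fun _ hξ => norm_ne_zero_iff.2 hξ

theorem norm_inv_smul_mem_sphere {ξ : E} (hξ : ξ ≠ 0) : ‖ξ‖⁻¹ • ξ ∈ Metric.sphere (0 : E) 1 := by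
  simp [norm_smul, norm_ne_zero_iff.2 hξ]

theorem norm_inv_smul_ne_zero {ξ : E} (hξ : ξ ≠ 0) : ‖ξ‖⁻¹ • ξ ≠ 0 :=
  ne_zero_of_mem_unit_sphere ⟨_, norm_inv_smul_mem_sphere hξ⟩

/-- The logarithm of the angular part `ξ ↦ σ (ξ / |ξ|)` of a positive function `σ` on `E ∖ {0}`.
It depends only on the values of `σ` on the unit sphere, and a homogeneous `σ` of degree `k` is
recovered from it as `|ξ|^k exp (logAngular σ ξ)`. -/
noncomputable def logAngular (σ : E → ℝ) (ξ : E) : ℝ :=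
  Real.log (σ (‖ξ‖⁻¹ • ξ))

theorem logAngular_smul (σ : E → ℝ) {r : ℝ} (hr : 0 < r) (ξ : E) :
    logAngular σ (r • ξ) = logAngular σ ξ := by
  rw [logAngular, logAngular, norm_smul, Real.norm_of_nonneg hr.le, mul_inv, smul_smul,
    mul_right_comm, inv_mul_cancel₀ hr.ne', one_mul]

theorem eqOn_logAngular {σ' : E → ℝ} (h : EqOn σ σ' (Metric.sphere 0 1)) :
    EqOn (logAngular σ) (logAngular σ') {0}ᶜ := fun ξ hξ => by
  rw [logAngular, logAngular, h (norm_inv_smul_mem_sphere hξ)]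

theorem contDiffOn_logAngular (hσ : ContDiffOn ℝ ∞ σ {0}ᶜ) (hpos : ∀ ξ, ξ ≠ 0 → 0 < σ ξ) :
    ContDiffOn ℝ ∞ (logAngular σ) {0}ᶜ := by
  have hnorm : ContDiffOn ℝ ∞ (fun ξ : E => ‖ξ‖) {0}ᶜ := contDiffOn_id.norm ℝ fun _ hξ => hξ
  have hproj : ContDiffOn ℝ ∞ (fun ξ : E => ‖ξ‖⁻¹ • ξ) {0}ᶜ :=
    (hnorm.inv fun _ hξ => norm_ne_zero_iff.2 hξ).smul contDiffOn_id
  exact (hσ.comp hproj fun _ hξ => norm_inv_smul_ne_zero hξ).log fun _ hξ =>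
    (hpos _ (norm_inv_smul_ne_zero hξ)).ne'

variable [FiniteDimensional ℝ E]

theorem exists_abs_logAngular_le (hσ : ContDiffOn ℝ ∞ σ {0}ᶜ) (hpos : ∀ ξ, ξ ≠ 0 → 0 < σ ξ) :
    ∃ B, ∀ ξ ≠ 0, |logAngular σ ξ| ≤ B := by
  have := FiniteDimensional.proper_real E
  obtain ⟨B, hB⟩ := (isCompact_sphere (0 : E) 1).exists_bound_of_continuousOn
    ((contDiffOn_logAngular hσ hpos).continuousOn.mono fun u hu =>
      ne_zero_of_mem_unit_sphere ⟨u, hu⟩)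
  refine ⟨B, fun ξ hξ => ?_⟩
  rw [← logAngular_smul σ (inv_pos.2 (norm_pos_iff.2 hξ))]
  exact hB _ (norm_inv_smul_mem_sphere hξ)

theorem exists_norm_iteratedFDerivWithin_logAngular_le (hσ : ContDiffOn ℝ ∞ σ {0}ᶜ)
    (hpos : ∀ ξ, ξ ≠ 0 → 0 < σ ξ) (m : ℕ) :
    ∃ B, ∀ j ≤ m, j ≠ 0 → ∀ ξ ≠ 0,
      ‖iteratedFDerivWithin ℝ j (logAngular σ) {0}ᶜ ξ‖ ≤ B * ‖ξ‖⁻¹ ^ j :=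
  exists_norm_iteratedFDerivWithin_le_mul_norm_inv_pow (contDiffOn_logAngular hσ hpos)
    (fun r hr => ⟨0, fun ξ _ => by rw [logAngular_smul σ hr, add_zero]⟩) m

theorem exists_norm_iteratedFDerivWithin_log_norm_le (m : ℕ) :
    ∃ B, ∀ j ≤ m, j ≠ 0 → ∀ ξ : E, ξ ≠ 0 →
      ‖iteratedFDerivWithin ℝ j (fun ξ : E => Real.log ‖ξ‖) {0}ᶜ ξ‖ ≤ B * ‖ξ‖⁻¹ ^ j := by
  refine exists_norm_iteratedFDerivWithin_le_mul_norm_inv_pow contDiffOn_log_norm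
    (fun r hr => ⟨Real.log r, fun ξ hξ => ?_⟩) m
  rw [norm_smul, Real.norm_of_nonneg hr.le, Real.log_mul hr.ne' (norm_ne_zero_iff.2 hξ), add_comm]

theorem exists_one_le_forall_eqOn_sphere_logAngular_bounds (hσ : ContDiffOn ℝ ∞ σ {0}ᶜ)
    (hpos : ∀ ξ, ξ ≠ 0 → 0 < σ ξ) (m : ℕ) :
    ∃ B, 1 ≤ B ∧ ∀ σ' : E → ℝ, EqOn σ' σ (Metric.sphere 0 1) → ∀ ξ ≠ 0,
      |logAngular σ' ξ| ≤ B ∧ ∀ j ≤ m, j ≠ 0 →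
        ‖iteratedFDerivWithin ℝ j (fun η : E => Real.log ‖η‖) {0}ᶜ ξ‖ ≤ B * ‖ξ‖⁻¹ ^ j ∧
        ‖iteratedFDerivWithin ℝ j (logAngular σ') {0}ᶜ ξ‖ ≤ B * ‖ξ‖⁻¹ ^ j := by
  obtain ⟨B₀, hB₀⟩ := exists_abs_logAngular_le hσ hpos
  obtain ⟨B₁, hB₁⟩ := exists_norm_iteratedFDerivWithin_log_norm_le (E := E) m
  obtain ⟨B₂, hB₂⟩ := exists_norm_iteratedFDerivWithin_logAngular_le hσ hpos m
  obtain ⟨B, hB⟩ := ({1, B₀, B₁, B₂} : Finset ℝ).exists_le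
  simp only [Finset.mem_insert, Finset.mem_singleton, forall_eq_or_imp, forall_eq] at hB
  obtain ⟨h1, h₀, h₁, h₂⟩ := hB
  refine ⟨B, h1, fun σ' hσ' ξ hξ => ⟨?_, fun j hjm hj => ⟨?_, ?_⟩⟩⟩
  · rw [eqOn_logAngular hσ' hξ]
    exact (hB₀ ξ hξ).trans h₀
  · exact (hB₁ j hjm hj ξ hξ).trans (by gcongr)
  · rw [iteratedFDerivWithin_congr (eqOn_logAngular hσ') hξ]
    exact (hB₂ j hjm hj ξ hξ).trans (by gcongr)

end LogAngular

section Symbol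

variable {N : ℕ} {α β k δ : ℝ} {σ : EuclideanSpace ℝ (Fin N) → ℝ}

theorem HomogeneousOfDegree.log_eq (hσ : HomogeneousOfDegree k σ) (hpos : ∀ ξ, ξ ≠ 0 → 0 < σ ξ)
    {ξ : EuclideanSpace ℝ (Fin N)} (hξ : ξ ≠ 0) :
    Real.log (σ ξ) = k * Real.log ‖ξ‖ + logAngular σ ξ := by
  have hn : 0 < ‖ξ‖ := norm_pos_iff.2 hξ
  have hu : ‖ξ‖⁻¹ • ξ ≠ 0 := norm_inv_smul_ne_zero hξ
  rw [logAngular, ← Real.log_rpow hn,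
    ← Real.log_mul (Real.rpow_pos_of_pos hn k).ne' (hpos _ hu).ne', ← hσ _ hn _ hu,
    smul_inv_smul₀ hn.ne']

theorem contDiffOn_norm_rpow_mul_mittagLeffler (hα : 0 < α) (β δ : ℝ)
    (hσ : ContDiffOn ℝ ∞ σ {0}ᶜ) :
    ContDiffOn ℝ ∞ (fun ξ : EuclideanSpace ℝ (Fin N) =>
      ((‖ξ‖ ^ δ : ℝ) : ℂ) * mittagLeffler α β (-(σ ξ : ℂ))) {0}ᶜ := by
  have hnorm : ContDiffOn ℝ ∞ (fun ξ : EuclideanSpace ℝ (Fin N) => ‖ξ‖ ^ δ) {0}ᶜ :=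
    (contDiffOn_id.norm ℝ fun ξ hξ => hξ).rpow_const_of_ne fun ξ hξ => norm_ne_zero_iff.2 hξ
  have hML : ContDiff ℝ ∞ (mittagLeffler α β) :=
    ((differentiable_mittagLeffler hα β).contDiff (n := ∞)).restrict_scalars ℝ
  exact (Complex.ofRealCLM.contDiff.comp_contDiffOn hnorm).mul
    (hML.comp_contDiffOn (Complex.ofRealCLM.contDiff.comp_contDiffOn hσ).neg)

theorem HomogeneousOfDegree.norm_rpow_mul_mittagLeffler_eq (hσ : HomogeneousOfDegree k σ)
    (hk : k ≠ 0) (hpos : ∀ ξ, ξ ≠ 0 → 0 < σ ξ) (α β δ : ℝ) {ξ : EuclideanSpace ℝ (Fin N)}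
    (hξ : ξ ≠ 0) :
    ((‖ξ‖ ^ δ : ℝ) : ℂ) * mittagLeffler α β (-(σ ξ : ℂ)) =
      Real.exp (-(δ / k) * logAngular σ ξ) • logMittagLeffler α β (δ / k) (Real.log (σ ξ)) := by
  have hnorm : ‖ξ‖ ^ δ =
      Real.exp (-(δ / k) * logAngular σ ξ) * Real.exp (δ / k * Real.log (σ ξ)) := by
    rw [← Real.exp_add, hσ.log_eq hpos hξ, Real.rpow_def_of_pos (norm_pos_iff.2 hξ)]
    congr 1
    field_simp
    ring
  rw [logMittagLeffler, Complex.real_smul, hnorm, ← Complex.ofReal_exp (Real.log _),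
    Real.exp_log (hpos ξ hξ)]
  push_cast
  ring

theorem HomogeneousOfDegree.norm_iteratedFDerivWithin_log_le (hσ : HomogeneousOfDegree k σ)
    (hk : 0 ≤ k) (hsmooth : ContDiffOn ℝ ∞ σ {0}ᶜ) (hpos : ∀ ξ, ξ ≠ 0 → 0 < σ ξ)
    {ξ : EuclideanSpace ℝ (Fin N)} (hξ : ξ ≠ 0) {j : ℕ} {b : ℝ}
    (hnorm : ‖iteratedFDerivWithin ℝ j (fun η : EuclideanSpace ℝ (Fin N) => Real.log ‖η‖) {0}ᶜ ξ‖
      ≤ b)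
    (hang : ‖iteratedFDerivWithin ℝ j (logAngular σ) {0}ᶜ ξ‖ ≤ b) :
    ‖iteratedFDerivWithin ℝ j (fun η => Real.log (σ η)) {0}ᶜ ξ‖ ≤ (1 + k) * b := by
  have huniq : UniqueDiffOn ℝ ({0}ᶜ : Set (EuclideanSpace ℝ (Fin N))) :=
    isOpen_compl_singleton.uniqueDiffOn
  have hlog : ContDiffWithinAt ℝ j (fun η : EuclideanSpace ℝ (Fin N) => Real.log ‖η‖) {0}ᶜ ξ :=
    (contDiffOn_log_norm ξ hξ).of_le (by exact_mod_cast le_top)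
  have hklog : ContDiffWithinAt ℝ j (k • fun η : EuclideanSpace ℝ (Fin N) => Real.log ‖η‖) {0}ᶜ ξ :=
    hlog.const_smul k
  have heq : EqOn (fun η => Real.log (σ η)) ((k • fun η => Real.log ‖η‖) + logAngular σ) {0}ᶜ :=
    fun η hη => hσ.log_eq hpos hη
  rw [iteratedFDerivWithin_congr heq hξ, iteratedFDerivWithin_add_apply hklog
    ((contDiffOn_logAngular hsmooth hpos ξ hξ).of_le (by exact_mod_cast le_top)) huniq hξ,
    iteratedFDerivWithin_const_smul_apply hlog huniq hξ]
  refine (norm_add_le _ _).trans ?_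
  rw [norm_smul, Real.norm_of_nonneg hk]
  linarith [mul_le_mul_of_nonneg_left hnorm hk]

theorem HomogeneousOfDegree.norm_iteratedFDerivWithin_norm_rpow_mul_mittagLeffler_le
    (hσ : HomogeneousOfDegree k σ) (hk : 0 < k) (hsmooth : ContDiffOn ℝ ∞ σ {0}ᶜ)
    (hpos : ∀ ξ, ξ ≠ 0 → 0 < σ ξ) (hα : 0 < α) {B C : ℝ} (hB : 1 ≤ B) {n : ℕ}
    (hτ : δ / k ∈ Icc (0 : ℝ) 1)
    (hC : ∀ i ≤ n, ∀ x, ‖iteratedFDeriv ℝ i (logMittagLeffler α β (δ / k)) x‖ ≤ C)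
    {ξ : EuclideanSpace ℝ (Fin N)} (hξ : ξ ≠ 0) (hangB : |logAngular σ ξ| ≤ B)
    (hderiv : ∀ j ≤ n, j ≠ 0 →
      ‖iteratedFDerivWithin ℝ j (fun η : EuclideanSpace ℝ (Fin N) => Real.log ‖η‖) {0}ᶜ ξ‖
        ≤ B * ‖ξ‖⁻¹ ^ j ∧
      ‖iteratedFDerivWithin ℝ j (logAngular σ) {0}ᶜ ξ‖ ≤ B * ‖ξ‖⁻¹ ^ j) :
    ‖iteratedFDerivWithin ℝ n (fun η : EuclideanSpace ℝ (Fin N) =>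
        ((‖η‖ ^ δ : ℝ) : ℂ) * mittagLeffler α β (-(σ η : ℂ))) {0}ᶜ ξ‖ ≤
      (n + 1)! * Real.exp B * C * ((1 + k) * B * ‖ξ‖⁻¹) ^ n := by
  have hpow (j : ℕ) (hj : j ≠ 0) :
      (1 + k) * (B * ‖ξ‖⁻¹ ^ j) ≤ ((1 + k) * B * ‖ξ‖⁻¹) ^ j := by
    rw [← mul_assoc, mul_pow _ ‖ξ‖⁻¹]
    gcongr
    exact le_self_pow₀ (by nlinarith) hj
  have heq : EqOn (fun η : EuclideanSpace ℝ (Fin N) =>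
        ((‖η‖ ^ δ : ℝ) : ℂ) * mittagLeffler α β (-(σ η : ℂ)))
      (fun η => Real.exp (-(δ / k) * logAngular σ η) •
        logMittagLeffler α β (δ / k) (Real.log (σ η))) {0}ᶜ :=
    fun η hη => hσ.norm_rpow_mul_mittagLeffler_eq hk.ne' hpos α β δ hη
  rw [iteratedFDerivWithin_congr heq hξ]
  refine norm_iteratedFDerivWithin_exp_smul_comp_le (contDiffOn_logAngular hsmooth hpos)
    (hsmooth.log fun η hη => (hpos η hη).ne') (contDiff_logMittagLeffler hα β _)
    isOpen_compl_singleton.uniqueDiffOn hξ hτ hangB (fun j hjn hj => ?_) (fun j hjn hj => ?_)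
    fun j hj => hC j hj _
  · refine ((hderiv j hjn hj).2.trans ?_).trans (hpow j hj)
    exact le_mul_of_one_le_left (by positivity) (by linarith)
  · exact (hσ.norm_iteratedFDerivWithin_log_le hk.le hsmooth hpos hξ (hderiv j hjn hj).1
      (hderiv j hjn hj).2).trans (hpow j hj)

theorem exists_symbolBound_norm_rpow_mul_mittagLeffler (i : Fin N) (hα : 0 < α) (hα₂ : α < 2)
    (β : ℝ) {σ₀ : EuclideanSpace ℝ (Fin N) → ℝ} (hσ₀ : ContDiffOn ℝ ∞ σ₀ {0}ᶜ)
    (hpos₀ : ∀ ξ, ξ ≠ 0 → 0 < σ₀ ξ) :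
    ∃ C : ℝ, 0 < C ∧ ∀ (k δ A : ℝ) (σ : EuclideanSpace ℝ (Fin N) → ℝ), 0 < k →
      ContDiffOn ℝ ∞ σ {0}ᶜ → (∀ ξ, ξ ≠ 0 → 0 < σ ξ) → HomogeneousOfDegree k σ →
      EqOn σ σ₀ (Metric.sphere 0 1) → SymbolBound k A σ → 0 ≤ δ → δ ≤ k →
        SymbolBound 0 (C * A) fun ξ : EuclideanSpace ℝ (Fin N) =>
          ((‖ξ‖ ^ δ : ℝ) : ℂ) * mittagLeffler α β (-(σ ξ : ℂ)) := by
  set M := N / 2 + 1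
  obtain ⟨B, hB, hangular⟩ := exists_one_le_forall_eqOn_sphere_logAngular_bounds hσ₀ hpos₀ M
  obtain ⟨C₀, hC₀⟩ := exists_norm_iteratedFDeriv_logMittagLeffler_le hα hα₂ β M
  set C := max 1 C₀
  have hCpos : 0 < C := one_pos.trans_le (le_max_left _ _)
  have he : EuclideanSpace.single i (1 : ℝ) ∈ Metric.sphere (0 : EuclideanSpace ℝ (Fin N)) 1 := by
    simp
  have hσe := hpos₀ _ (ne_zero_of_mem_unit_sphere ⟨_, he⟩)
  refine ⟨(M + 1)! * Real.exp B * C * B ^ M * ((M + 1) ^ M / σ₀ (EuclideanSpace.single i 1)),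
    by positivity, fun k δ A σ hk hσ hpos hhom hEq hA hδ hδk γ hγ ξ hξ => ?_⟩
  have hdegree : (1 + k) ^ M ≤ (M + 1) ^ M / σ₀ (EuclideanSpace.single i 1) * A := by
    have h := hA.one_add_pow_mul_le hk.le hhom i (hEq he ▸ hσe.le)
    rw [hEq he] at h
    rwa [div_mul_eq_mul_div, le_div_iff₀ hσe]
  have hτ : δ / k ∈ Icc (0 : ℝ) 1 := ⟨by positivity, (div_le_one hk).2 hδk⟩
  obtain ⟨hangB, hderiv⟩ := hangular σ hEq ξ hξ
  set n := multiLength γ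
  calc ‖multiDeriv γ _ ξ‖ ≤ ‖iteratedFDerivWithin ℝ n _ {0}ᶜ ξ‖ :=
        norm_multiDeriv_le isOpen_compl_singleton
          (contDiffOn_norm_rpow_mul_mittagLeffler hα β δ hσ) γ hξ
    _ ≤ (n + 1)! * Real.exp B * C * ((1 + k) * B * ‖ξ‖⁻¹) ^ n :=
        hhom.norm_iteratedFDerivWithin_norm_rpow_mul_mittagLeffler_le hk hσ hpos hα hB hτ
          (fun i hi x => (hC₀ _ hτ i (hi.trans hγ) x).trans (le_max_right _ _)) hξ hangB
          fun j hj => hderiv j (hj.trans hγ)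
    _ = (n + 1)! * Real.exp B * C * B ^ n * (1 + k) ^ n * ‖ξ‖⁻¹ ^ n := by
        rw [mul_pow, mul_pow]
        ring
    _ ≤ (M + 1)! * Real.exp B * C * B ^ M *
          ((M + 1) ^ M / σ₀ (EuclideanSpace.single i 1) * A) * ‖ξ‖⁻¹ ^ n := by
        gcongr
        exact (pow_le_pow_right₀ (by linarith) hγ).trans hdegree
    _ = _ := by
        rw [zero_sub, Real.rpow_neg (norm_nonneg ξ), Real.rpow_natCast, inv_pow]
        ring

end Symbol

theorem proposition4p3_general (N : ℕ) (α β : ℝ) (hα : 0 < α) (hα₂ : α < 2)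
    (θ : Metric.sphere (0 : EuclideanSpace ℝ (Fin N)) 1 → ℝ) :
    ∃ C : ℝ, 0 < C ∧
      ∀ (k δ A : ℝ) (σ : EuclideanSpace ℝ (Fin N) → ℝ),
        0 < k →
        ContDiffOn ℝ ∞ σ {0}ᶜ →
        (∀ ξ, ξ ≠ 0 → 0 < σ ξ) →
        HomogeneousOfDegree k σ →
        (∀ u : Metric.sphere (0 : EuclideanSpace ℝ (Fin N)) 1, σ u = θ u) →
        SymbolBound k A σ →
        0 ≤ δ → δ ≤ k →
          ContDiffOn ℝ ∞
            (fun ξ : EuclideanSpace ℝ (Fin N) =>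
              ((‖ξ‖ ^ δ : ℝ) : ℂ) * mittagLeffler α β (-(σ ξ : ℂ))) {0}ᶜ ∧
          SymbolBound 0 (C * A) fun ξ : EuclideanSpace ℝ (Fin N) =>
            ((‖ξ‖ ^ δ : ℝ) : ℂ) * mittagLeffler α β (-(σ ξ : ℂ)) := by
  rcases isEmpty_or_nonempty (Fin N) with _ | ⟨⟨i⟩⟩
  · exact ⟨1, one_pos, fun k δ A σ _ hσ _ _ _ _ _ _ =>
      ⟨contDiffOn_norm_rpow_mul_mittagLeffler hα β δ hσ,
        fun γ _ ξ hξ => absurd (Subsingleton.elim ξ 0) hξ⟩⟩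
  -- `C` may depend on `σ` only through `θ`, so it is read off from any one smooth positive
  -- extension `σ₀` of `θ`.
  by_cases hθ : ∃ σ₀ : EuclideanSpace ℝ (Fin N) → ℝ, ContDiffOn ℝ ∞ σ₀ {0}ᶜ ∧
      (∀ ξ, ξ ≠ 0 → 0 < σ₀ ξ) ∧ ∀ u : Metric.sphere (0 : EuclideanSpace ℝ (Fin N)) 1, σ₀ u = θ u
  · obtain ⟨σ₀, hσ₀, hpos₀, hθ₀⟩ := hθ
    obtain ⟨C, hC, hbound⟩ := exists_symbolBound_norm_rpow_mul_mittagLeffler i hα hα₂ β hσ₀ hpos₀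
    exact ⟨C, hC, fun k δ A σ hk hσ hpos hhom hσθ hA hδ hδk =>
      ⟨contDiffOn_norm_rpow_mul_mittagLeffler hα β δ hσ, hbound k δ A σ hk hσ hpos hhom
        (fun u hu => (hσθ ⟨u, hu⟩).trans (hθ₀ ⟨u, hu⟩).symm) hA hδ hδk⟩⟩
  · exact ⟨1, one_pos, fun k δ A σ _ hσ hpos _ hσθ _ _ _ => absurd ⟨σ, hσ, hpos, hσθ⟩ hθ⟩

theorem proposition4p3 (N : ℕ) (α β : ℝ) (hα₁ : 1 < α) (hα₂ : α < 2) (hβ : 0 < β)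
    (θ : Metric.sphere (0 : EuclideanSpace ℝ (Fin N)) 1 → ℝ) :
    ∃ C : ℝ, 0 < C ∧
      ∀ (k δ A : ℝ) (σ : EuclideanSpace ℝ (Fin N) → ℝ),
        0 < k →
        ContDiffOn ℝ ∞ σ {0}ᶜ →
        (∀ ξ, ξ ≠ 0 → 0 < σ ξ) →
        HomogeneousOfDegree k σ →
        (∀ u : Metric.sphere (0 : EuclideanSpace ℝ (Fin N)) 1, σ u = θ u) →
        SymbolBound k A σ →
        0 ≤ δ → k * (β / α - 1 / α) ≤ δ → δ < k →
          ContDiffOn ℝ ∞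
            (fun ξ : EuclideanSpace ℝ (Fin N) =>
              ((‖ξ‖ ^ δ : ℝ) : ℂ) * mittagLeffler α β (-(σ ξ : ℂ))) {0}ᶜ ∧
          ∀ γ : Fin N → ℕ, multiLength γ ≤ N / 2 + 1 →
            ∀ ξ : EuclideanSpace ℝ (Fin N), ξ ≠ 0 →
              ‖multiDeriv γ
                  (fun η : EuclideanSpace ℝ (Fin N) =>
                    ((‖η‖ ^ δ : ℝ) : ℂ) * mittagLeffler α β (-(σ η : ℂ))) ξ‖
                ≤ C * A * ‖ξ‖ ^ (-(multiLength γ : ℝ)) := by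
  obtain ⟨C, hC, h⟩ := proposition4p3_general N α β (one_pos.trans hα₁) hα₂ θ
  refine ⟨C, hC, fun k δ A σ hk hσ hpos hhom hσθ hA hδ _ hδk => ?_⟩
  simpa only [SymbolBound, zero_sub] using h k δ A σ hk hσ hpos hhom hσθ hA hδ hδk.le
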